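/- Let $Q=(q_n)_{n\ge 1}$ be a basic sequence, i.e. a sequence of integers $q_n\ge 2$. Every real $x$ has a unique $Q$-Cantor series expansion $x=E_0+\sum_{n\ge 1}\frac{E_n}{q_1q_2\cdots q_n}$ with $E_0=\lfloor x\rfloor$, $E_n\in\{0,1,\dots,q_n-1\}$ for $n\ge 1$, and $E_n\ne q_n-1$ for infinitely many $n$; we write $x=E_0.E_1E_2\cdots$ w.r.t. $Q$. For a sequence $(x_n)$ of reals let $\mathbb{A}((x_n))$ denote its set of accumulation points, i.e. the set of limits of its convergent subsequences. For $D\subseteq[0,1]$ and a sequence $(t_n)_{n\ge1}$ of non-negative integers put $$\mathbb{E}_{D,(t_n)}(Q)=\left\{x=0.E_1E_2\cdots \text{ w.r.t. } Q:\ \mathbb{A}((E_n/q_n))=D \text{ and } E_n<q_n-t_n \text{ for all } n\ge 1\right\}.$$ Theorem. Let $D\subseteq(0,1)$ be a non-empty set that is closed in $\mathbb{R}$, let $(t_n)_{n\ge 1}$ be a sequence of non-negative integers, and let $Q=(q_n)_{n\ge1}$ be a basic sequence with $\lim_{n\to\infty}q_n=\infty$. Suppose that $$\lim_{n\to\infty}\frac{\log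 q_{n+j}}{\log(q_1q_2\cdots q_n)}=0\quad\text{for every integer } j\ge 1,$$ that $\sum_{n=1}^\infty \frac{t_n}{q_n}<\infty$, and that $q_n-t_n\ge 3$ for all $n\ge1$. Then the Hausdorff dimension of $\mathbb{E}_{D,(t_n)}(Q)$ equals $1$. -/

import Mathlib

open Filter Topology

/-- A basic sequence `(q_1, q_2, …)` of integers `≥ 2`. All sequences are indexed from `0`:
`q n` stands for `q_{n+1}`. -/
def IsBasicSequence (q : ℕ → ℕ) : Prop :=
  ∀ n, 2 ≤ q n

/-- `q_1 q_2 ⋯ q_n`, the product of the first `n` terms. -/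
def partialProd (q : ℕ → ℕ) (n : ℕ) : ℕ :=
  ∏ i ∈ Finset.range n, q i

/-- `x = E_0.E_1E_2⋯` with respect to `q`: this is the Cantor series expansion of `x`, with
`E_0 = ⌊x⌋`, digits `E_n ∈ {0, …, q_n - 1}`, `E_n ≠ q_n - 1` infinitely often, and
`x = E_0 + ∑_{n ≥ 1} E_n / (q_1 ⋯ q_n)`. Here `E n` stands for `E_{n+1}`. -/
def IsCantorExpansion (q : ℕ → ℕ) (x : ℝ) (E₀ : ℤ) (E : ℕ → ℕ) : Prop :=
  E₀ = ⌊x⌋ ∧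
  (∀ n, E n < q n) ∧
  (∃ᶠ n in atTop, E n + 1 ≠ q n) ∧
  HasSum (fun n => (E n : ℝ) / (partialProd q (n + 1) : ℝ)) (x - E₀)

/-- The set of accumulation points (limits of subsequences) of a sequence of reals. -/
def accumulationSet (u : ℕ → ℝ) : Set ℝ :=
  {y | MapClusterPt y atTop u}

/-- The set of `x = 0.E_1E_2⋯` with respect to `q` for which the accumulation points of
`(E_n / q_n)` form exactly the set `D` and `E_n < q_n - t_n` for every `n`. -/
def restrictedAccumulationSet (D : Set ℝ) (t q : ℕ → ℕ) : Set ℝ :=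
  {x | ∃ E : ℕ → ℕ, IsCantorExpansion q x 0 E ∧
    accumulationSet (fun n => (E n : ℝ) / (q n : ℝ)) = D ∧
    ∀ n, (E n : ℤ) < (q n : ℤ) - (t n : ℤ)}

/-!
The lower bound for the dimension comes from a Cantor-type subset. Let `d` be a sequence in `D`
that comes close to every point of `D` infinitely often, so that its accumulation set is `D`
(`exists_accumulationSet_eq`). Fix `s < r < 1` and allow, at position `n`, only the roughly
`q n ^ r` digits that start at `d n * q n` (`exists_digit_windows`). Since `q n ^ r / q n → 0`,
the digit quotients of every resulting number differ from `d n` by `o(1)`, so they accumulate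
exactly at `D`.
As `D` is compact in `(0, 1)` and `t n / q n → 0`, the windows stay below `q n - t n`.

Let `M n` be the number of digits in the `n`-th window. Reading the offsets within the windows as
digits with respect to the bases `M` maps this set onto `[0, 1)`. Two points whose digits first
differ at position `m` are at distance at least `1 / (2 q_0 ⋯ q_m)`, because the windows take up
at most about half of all digits (`le_abs_cantorValue_sub`), while their images are at distance at
most `1 / (M_0 ⋯ M_{m-1})` (`exists_first_cantorDigit_ne`). The growth condition gives
`q_m ≤ (q_0 ⋯ q_{m-1}) ^ ε` eventually, so `(q_0 ⋯ q_m) ^ s = O(M_0 ⋯ M_{m-1})`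
(`exists_partialProd_rpow_le`). The map is therefore Hölder of exponent `s`, and the set has
dimension at least `s` (`le_dimH_of_digit_windows`).
-/

/-! ### Values of Cantor series -/

theorem partialProd_succ (q : ℕ → ℕ) (n : ℕ) :
    partialProd q (n + 1) = partialProd q n * q n :=
  Finset.prod_range_succ q n

theorem partialProd_pos {q : ℕ → ℕ} (hq : ∀ n, 1 ≤ q n) (n : ℕ) : 0 < partialProd q n :=
  Finset.prod_pos fun i _ => hq i

theorem two_pow_le_partialProd {q : ℕ → ℕ} (hq : IsBasicSequence q) (n : ℕ) :
    2 ^ n ≤ partialProd q n := by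
  have := Finset.pow_card_le_prod (Finset.range n) q 2 fun i _ => hq i
  rwa [Finset.card_range] at this

theorem tendsto_partialProd_atTop {q : ℕ → ℕ} (hq : IsBasicSequence q) :
    Tendsto (fun n => (partialProd q n : ℝ)) atTop atTop := by
  refine tendsto_atTop_mono (fun n => ?_)
    (tendsto_pow_atTop_atTop_of_one_lt (one_lt_two : (1 : ℝ) < 2))
  exact_mod_cast two_pow_le_partialProd hq n

/-- The real number with digits `E` after the radix point with respect to `q`. The
series converges as soon as `E n < q n` for all `n`. -/
noncomputable def cantorValue (q E : ℕ → ℕ) : ℝ :=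
  ∑' n, (E n : ℝ) / (partialProd q (n + 1) : ℝ)

/-- The weight of a maximal digit telescopes. -/
theorem sub_one_div_partialProd_succ {q : ℕ → ℕ} (hq : ∀ n, 1 ≤ q n) (n : ℕ) :
    ((q n : ℝ) - 1) / partialProd q (n + 1) =
      1 / (partialProd q n : ℝ) - 1 / (partialProd q (n + 1) : ℝ) := by
  have h1 : (partialProd q n : ℝ) ≠ 0 := by exact_mod_cast (partialProd_pos hq n).ne'
  have h2 : (q n : ℝ) ≠ 0 := by exact_mod_cast (Nat.one_le_iff_ne_zero.1 (hq n))
  rw [partialProd_succ]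
  push_cast
  field_simp

theorem hasSum_maximal_digits {q : ℕ → ℕ} (hq : IsBasicSequence q) :
    HasSum (fun n => ((q n : ℝ) - 1) / partialProd q (n + 1)) 1 := by
  have hq1 : ∀ n, 1 ≤ q n := fun n => one_le_two.trans (hq n)
  rw [hasSum_iff_tendsto_nat_of_nonneg]
  · have hpart : ∀ n, ∑ i ∈ Finset.range n, ((q i : ℝ) - 1) / partialProd q (i + 1) =
        1 - 1 / (partialProd q n : ℝ) := by
      intro n
      simp_rw [sub_one_div_partialProd_succ hq1]
      rw [Finset.sum_range_sub']
      simp [partialProd]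
    simp_rw [hpart]
    simpa using tendsto_const_nhds.sub ((tendsto_partialProd_atTop hq).const_div_atTop 1)
  · intro n
    have : (1 : ℝ) ≤ q n := by exact_mod_cast hq1 n
    exact div_nonneg (by linarith) (by positivity)

theorem digit_term_le {q E : ℕ → ℕ} {n : ℕ} (hE : E n < q n) :
    (E n : ℝ) / partialProd q (n + 1) ≤ ((q n : ℝ) - 1) / partialProd q (n + 1) := by
  have : (E n : ℝ) + 1 ≤ q n := by exact_mod_cast hE
  gcongr
  linarith

theorem hasSum_cantorValue {q E : ℕ → ℕ} (hq : IsBasicSequence q) (hE : ∀ n, E n < q n) :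
    HasSum (fun n => (E n : ℝ) / (partialProd q (n + 1) : ℝ)) (cantorValue q E) :=
  (Summable.of_nonneg_of_le (fun _ => by positivity) (fun _ => digit_term_le (hE _))
    (hasSum_maximal_digits hq).summable).hasSum

theorem isCantorExpansion_cantorValue {q E : ℕ → ℕ} (hq : IsBasicSequence q)
    (hE : ∀ n, E n + 1 < q n) : IsCantorExpansion q (cantorValue q E) 0 E := by
  have hE' : ∀ n, E n < q n := fun n => (Nat.lt_succ_self _).trans (hE n)
  refine ⟨?_, hE', Frequently.of_forall fun n => (hE n).ne, ?_⟩
  · symm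
    rw [Int.floor_eq_zero_iff]
    refine ⟨tsum_nonneg fun _ => by positivity, ?_⟩
    refine hasSum_lt (i := 0) (fun n => digit_term_le (hE' n)) ?_
      (hasSum_cantorValue hq hE') (hasSum_maximal_digits hq)
    have : (E 0 : ℝ) + 1 < q 0 := by exact_mod_cast hE 0
    have hpos : (0 : ℝ) < partialProd q (0 + 1) := by
      exact_mod_cast partialProd_pos (fun n => one_le_two.trans (hq n)) (0 + 1)
    gcongr
    linarith
  · simpa using hasSum_cantorValue hq hE'

/-- If two digit strings first differ at position `m`, and their later digits at each position `i`
differ by at most half of the maximum `q i - 1`, then the tails cannot cancel more than half of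
the contribution of position `m`. -/
theorem le_abs_cantorValue_sub {q E F : ℕ → ℕ} (hq : IsBasicSequence q) (hE : ∀ n, E n < q n)
    (hF : ∀ n, F n < q n) {m : ℕ} (heq : ∀ i < m, E i = F i) (hne : E m ≠ F m)
    (hclose : ∀ i, 2 * |(E i : ℝ) - F i| ≤ q i - 1) :
    1 / (2 * (partialProd q (m + 1) : ℝ)) ≤ |cantorValue q E - cantorValue q F| := by
  have hq1 : ∀ n, 1 ≤ q n := fun n => one_le_two.trans (hq n)
  have hpos : ∀ n, (0 : ℝ) < partialProd q n := fun n => by exact_mod_cast partialProd_pos hq1 n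
  set u : ℕ → ℝ := fun i => (E i : ℝ) / partialProd q (i + 1) - F i / partialProd q (i + 1)
  have hu : HasSum u (cantorValue q E - cantorValue q F) :=
    (hasSum_cantorValue hq hE).sub (hasSum_cantorValue hq hF)
  -- The bound for the partial sums carries the extra term `1 / Q_N` to make the induction close.
  have hpart : ∀ N, m + 1 ≤ N → (1 / 2) * (1 / (partialProd q (m + 1) : ℝ)
      + 1 / (partialProd q N : ℝ)) ≤ |∑ i ∈ Finset.range N, u i| := by
    intro N hN
    induction N, hN using Nat.le_induction with
    | base =>
      have hz : ∑ i ∈ Finset.range m, u i = 0 :=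
        Finset.sum_eq_zero fun i hi => by simp [u, heq i (Finset.mem_range.1 hi)]
      have hd : (1 : ℝ) ≤ |(E m : ℝ) - F m| := by
        have : (1 : ℤ) ≤ |(E m : ℤ) - F m| :=
          Int.one_le_abs (sub_ne_zero.2 (by exact_mod_cast hne))
        exact_mod_cast this
      have hm : u m = ((E m : ℝ) - F m) / partialProd q (m + 1) := by simp only [u, sub_div]
      rw [Finset.sum_range_succ, hz, zero_add, hm, abs_div, abs_of_pos (hpos (m + 1))]
      calc _ = 1 / (partialProd q (m + 1) : ℝ) := by ring
        _ ≤ _ := by gcongr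
    | succ N hN ih =>
      have hN' : |u N| ≤ 1 / 2 * (1 / (partialProd q N : ℝ) - 1 / partialProd q (N + 1)) := by
        rw [← sub_one_div_partialProd_succ hq1, ← mul_div_assoc]
        have : u N = ((E N : ℝ) - F N) / partialProd q (N + 1) := by simp only [u, sub_div]
        rw [this, abs_div, abs_of_pos (hpos (N + 1))]
        gcongr
        linarith [hclose N]
      have h3 : |∑ i ∈ Finset.range N, u i| ≤ |∑ i ∈ Finset.range (N + 1), u i| + |u N| := by
        have := abs_sub (∑ i ∈ Finset.range (N + 1), u i) (u N)
        rwa [Finset.sum_range_succ, add_sub_cancel_right, ← Finset.sum_range_succ] at this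
      linarith
  refine ge_of_tendsto (hu.tendsto_sum_nat.abs) ?_
  filter_upwards [eventually_ge_atTop (m + 1)] with N hN
  refine le_trans ?_ (hpart N hN)
  have : (0 : ℝ) < 1 / (partialProd q N : ℝ) := one_div_pos.2 (hpos N)
  have h2 : 1 / (2 * (partialProd q (m + 1) : ℝ)) = 1 / 2 * (1 / (partialProd q (m + 1) : ℝ)) := by
    field_simp
  rw [h2]
  linarith

/-! ### Digits with respect to variable bases -/

/-- The digit at position `n` of the expansion of `y ∈ [0, 1)` with respect to the bases `M`. -/
noncomputable def cantorDigit (M : ℕ → ℕ) (y : ℝ) (n : ℕ) : ℕ :=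
  ⌊(partialProd M (n + 1) : ℝ) * y⌋₊ % M n

theorem floor_partialProd_succ_mul {M : ℕ → ℕ} (hM : ∀ n, 1 ≤ M n) (y : ℝ) (n : ℕ) :
    ⌊(partialProd M (n + 1) : ℝ) * y⌋₊ =
      M n * ⌊(partialProd M n : ℝ) * y⌋₊ + cantorDigit M y n := by
  have hne : (M n : ℝ) ≠ 0 := by exact_mod_cast (Nat.one_le_iff_ne_zero.1 (hM n))
  have h : (partialProd M n : ℝ) * y = (partialProd M (n + 1) : ℝ) * y / M n := by
    rw [partialProd_succ]
    push_cast
    field_simp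
  rw [h, Nat.floor_div_natCast, cantorDigit, Nat.div_add_mod]

/-- Distinct points of `[0, 1)` have a first position with distinct digits, and the digits
before it bound their distance. -/
theorem exists_first_cantorDigit_ne {M : ℕ → ℕ} (hM : ∀ n, 1 ≤ M n)
    (hMinf : Tendsto (fun n => (partialProd M n : ℝ)) atTop atTop) {y z : ℝ}
    (hy : y ∈ Set.Ico (0 : ℝ) 1) (hz : z ∈ Set.Ico (0 : ℝ) 1) (hyz : y ≠ z) :
    ∃ m, (∀ i < m, cantorDigit M y i = cantorDigit M z i) ∧
      cantorDigit M y m ≠ cantorDigit M z m ∧ |y - z| ≤ 1 / (partialProd M m : ℝ) := by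
  have hpos : ∀ n, (0 : ℝ) < partialProd M n := fun n => by exact_mod_cast partialProd_pos hM n
  have habs : ∀ n, ⌊(partialProd M n : ℝ) * y⌋₊ = ⌊(partialProd M n : ℝ) * z⌋₊ →
      (partialProd M n : ℝ) * |y - z| < 1 := by
    intro n hn
    have hn' : (⌊(partialProd M n : ℝ) * y⌋₊ : ℝ) = ⌊(partialProd M n : ℝ) * z⌋₊ := by
      exact_mod_cast hn
    have a1 := Nat.floor_le (mul_nonneg (hpos n).le hy.1)
    have a2 := Nat.floor_le (mul_nonneg (hpos n).le hz.1)
    have b1 := Nat.lt_floor_add_one ((partialProd M n : ℝ) * y)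
    have b2 := Nat.lt_floor_add_one ((partialProd M n : ℝ) * z)
    rw [← abs_of_pos (hpos n), ← abs_mul, abs_lt, mul_sub]
    constructor <;> linarith
  have hex : ∃ n, ⌊(partialProd M n : ℝ) * y⌋₊ ≠ ⌊(partialProd M n : ℝ) * z⌋₊ := by
    obtain ⟨n, hn⟩ := (hMinf.eventually_ge_atTop (1 / |y - z|)).exists
    refine ⟨n, fun h => (habs n h).not_ge ?_⟩
    rwa [div_le_iff₀ (abs_pos.2 (sub_ne_zero.2 hyz))] at hn
  classical
  obtain ⟨m, hm⟩ : ∃ m, Nat.find hex = m + 1 := by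
    refine Nat.exists_eq_succ_of_ne_zero fun h => ?_
    have h0 := Nat.find_spec hex
    rw [h] at h0
    simp [partialProd, Nat.floor_eq_zero.2 hy.2, Nat.floor_eq_zero.2 hz.2] at h0
  have hlow : ∀ i ≤ m, ⌊(partialProd M i : ℝ) * y⌋₊ = ⌊(partialProd M i : ℝ) * z⌋₊ :=
    fun i hi => not_not.1 (Nat.find_min hex (by omega))
  have htop := Nat.find_spec hex
  rw [hm] at htop
  refine ⟨m, fun i hi => ?_, fun h => htop ?_, ?_⟩
  · have h := hlow (i + 1) hi
    rw [floor_partialProd_succ_mul hM, floor_partialProd_succ_mul hM, hlow i hi.le] at h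
    exact Nat.add_left_cancel h
  · rw [floor_partialProd_succ_mul hM, floor_partialProd_succ_mul hM, hlow m le_rfl, h]
  · rw [le_div_iff₀ (hpos m), mul_comm]
    exact (habs m (hlow m le_rfl)).le

/-! ### Hölder parametrization of sets given by digit windows -/

/-- Dimension bound for a set of Cantor series with digit windows `[a n, a n + M n)`: sending the
number with digits `a n + k n` to the number with digits `k n` in the bases `M` is Hölder of
exponent `s` and maps onto `[0, 1)`. -/
theorem le_dimH_of_digit_windows {q a M : ℕ → ℕ} (hq : IsBasicSequence q) (hM : ∀ n, 1 ≤ M n)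
    (hMq : ∀ n, 2 * M n ≤ q n + 1) (haM : ∀ n, a n + M n ≤ q n) {s : NNReal} (hs : 0 < s)
    {C : ℝ} (hC : 0 ≤ C)
    (hprod : ∀ n, (partialProd q (n + 1) : ℝ) ^ (s : ℝ) ≤ C * partialProd M n) {S : Set ℝ}
    (hS : ∀ k : ℕ → ℕ, (∀ n, k n < M n) → cantorValue q (fun n => a n + k n) ∈ S) :
    (s : ENNReal) ≤ dimH S := by
  have hq1 : ∀ n, 1 ≤ q n := fun n => one_le_two.trans (hq n)
  have hQpos : ∀ n, (0 : ℝ) < partialProd q n := fun n => by exact_mod_cast partialProd_pos hq1 n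
  have hPpos : ∀ n, (0 : ℝ) < partialProd M n := fun n => by exact_mod_cast partialProd_pos hM n
  have hs' : (0 : ℝ) < s := by exact_mod_cast hs
  have hC' : 0 < C := by
    refine hC.lt_of_ne fun h => ?_
    have := hprod 0
    rw [← h, zero_mul] at this
    exact (Real.rpow_pos_of_pos (hQpos 1) s).not_ge this
  have hMinf : Tendsto (fun n => (partialProd M n : ℝ)) atTop atTop := by
    have h2 := ((tendsto_rpow_atTop hs').comp
      ((tendsto_partialProd_atTop hq).comp (tendsto_add_atTop_nat 1))).atTop_div_const hC'
    refine tendsto_atTop_mono (fun n => ?_) h2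
    rw [div_le_iff₀ hC', mul_comm]
    exact hprod n
  have hk : ∀ y n, cantorDigit M y n < M n := fun y n => Nat.mod_lt _ (hM n)
  have hE : ∀ y n, a n + cantorDigit M y n < q n := fun y n => by
    have := hk y n
    have := haM n
    omega
  set g : ℝ → ℝ := fun y => cantorValue q (fun n => a n + cantorDigit M y n)
  have hgS : g '' Set.Ico 0 1 ⊆ S := by
    rintro _ ⟨y, -, rfl⟩
    exact hS _ (hk y)
  have hbound : ∀ y ∈ Set.Ico (0 : ℝ) 1, ∀ z ∈ Set.Ico (0 : ℝ) 1,
      |y - z| ≤ C * 2 ^ (s : ℝ) * |g y - g z| ^ (s : ℝ) := by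
    intro y hy z hz
    by_cases hyz : y = z
    · rw [hyz, sub_self, abs_zero]
      positivity
    obtain ⟨m, hlt, hne, hd⟩ := exists_first_cantorDigit_ne hM hMinf hy hz hyz
    have hsep : 1 / (2 * (partialProd q (m + 1) : ℝ)) ≤ |g y - g z| := by
      refine le_abs_cantorValue_sub hq (hE y) (hE z) (fun i hi => ?_) (fun h => ?_) (fun i => ?_)
      · rw [hlt i hi]
      · exact hne (Nat.add_left_cancel h)
      · have h1 : (cantorDigit M y i : ℝ) + 1 ≤ M i := by exact_mod_cast hk y i
        have h2 : (cantorDigit M z i : ℝ) + 1 ≤ M i := by exact_mod_cast hk z i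
        have h3 : 2 * (M i : ℝ) ≤ q i + 1 := by exact_mod_cast hMq i
        have h4 : (0 : ℝ) ≤ cantorDigit M y i := by positivity
        have h5 : (0 : ℝ) ≤ cantorDigit M z i := by positivity
        have : |(cantorDigit M y i : ℝ) - cantorDigit M z i| ≤ M i - 1 := by
          rw [abs_le]; constructor <;> linarith
        push_cast
        rw [add_sub_add_left_eq_sub]
        linarith
    have hQ := hQpos (m + 1)
    have hQs := Real.rpow_pos_of_pos hQ (s : ℝ)
    calc |y - z| ≤ 1 / (partialProd M m : ℝ) := hd
      _ ≤ C / (partialProd q (m + 1) : ℝ) ^ (s : ℝ) := by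
        rw [div_le_div_iff₀ (hPpos m) hQs, one_mul]
        exact hprod m
      _ = C * 2 ^ (s : ℝ) * (1 / (2 * (partialProd q (m + 1) : ℝ))) ^ (s : ℝ) := by
        rw [Real.div_rpow zero_le_one (by positivity), Real.one_rpow,
          Real.mul_rpow zero_le_two hQ.le]
        have : (2 : ℝ) ^ (s : ℝ) ≠ 0 := by positivity
        field_simp
      _ ≤ _ := by gcongr
  have hinj : Set.InjOn g (Set.Ico 0 1) := by
    intro y hy z hz h
    have := hbound y hy z hz
    rw [h, sub_self, abs_zero, Real.zero_rpow hs'.ne', mul_zero] at this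
    exact sub_eq_zero.1 (abs_nonpos_iff.1 this)
  have hholder : HolderOnWith (C * 2 ^ (s : ℝ)).toNNReal s (Function.invFunOn g (Set.Ico 0 1))
      (g '' Set.Ico 0 1) := by
    rintro _ ⟨y, hy, rfl⟩ _ ⟨z, hz, rfl⟩
    rw [hinj.leftInvOn_invFunOn hy, hinj.leftInvOn_invFunOn hz, edist_dist, edist_dist,
      Real.dist_eq, Real.dist_eq, ENNReal.ofReal_rpow_of_nonneg (abs_nonneg _) (NNReal.coe_nonneg s)]
    change _ ≤ ENNReal.ofReal _ * _
    rw [← ENNReal.ofReal_mul (by positivity)]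
    exact ENNReal.ofReal_le_ofReal (hbound y hy z hz)
  have hdim := hholder.dimH_image_le hs
  rw [hinj.invFunOn_image subset_rfl,
    Real.dimH_of_nonempty_interior (by rw [interior_Ico]; exact Set.nonempty_Ioo.2 one_pos),
    Module.finrank_self, Nat.cast_one,
    ENNReal.le_div_iff_mul_le (.inl (by exact_mod_cast hs.ne')) (.inl ENNReal.coe_ne_top),
    one_mul] at hdim
  exact hdim.trans (dimH_mono hgS)

/-- If almost all windows have at least `q n ^ r` digits with `r > s`, then the number of digit
strings `∏ i < n, M i` dominates `(∏ i ≤ n, q i) ^ s`, because the growth condition makes `q n` at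
most an arbitrarily small power of `∏ i < n, q i`. -/
theorem exists_partialProd_rpow_le {q M : ℕ → ℕ} (hq : IsBasicSequence q)
    (hlog : Tendsto (fun n => Real.log (q n : ℝ) / Real.log (partialProd q n : ℝ)) atTop (𝓝 0))
    (hM : ∀ n, 1 ≤ M n) {r s : ℝ} (hs : 0 < s) (hsr : s < r)
    (hqM : ∀ᶠ n in atTop, (q n : ℝ) ^ r ≤ M n) :
    ∃ C : ℝ, 0 ≤ C ∧ ∀ n, (partialProd q (n + 1) : ℝ) ^ s ≤ C * partialProd M n := by
  have hq1 : ∀ n, 1 ≤ q n := fun n => one_le_two.trans (hq n)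
  have hqpos : ∀ n, (0 : ℝ) < q n := fun n => by exact_mod_cast hq1 n
  have hQpos : ∀ n, (0 : ℝ) < partialProd q n := fun n => by exact_mod_cast partialProd_pos hq1 n
  have hPpos : ∀ n, (0 : ℝ) < partialProd M n := fun n => by exact_mod_cast partialProd_pos hM n
  obtain ⟨N, hN⟩ := eventually_atTop.1 hqM
  set c : ℝ := (partialProd q N : ℝ) ^ r
  have hc : 0 < c := Real.rpow_pos_of_pos (hQpos N) r
  have hQP : ∀ n, N ≤ n → (partialProd q n : ℝ) ^ r ≤ c * partialProd M n := by
    intro n hn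
    induction n, hn using Nat.le_induction with
    | base =>
      have : (1 : ℝ) ≤ partialProd M N := by exact_mod_cast partialProd_pos hM N
      exact le_mul_of_one_le_right hc.le this
    | succ n hn ih =>
      rw [partialProd_succ, partialProd_succ]
      push_cast
      rw [Real.mul_rpow (hQpos n).le (hqpos n).le, ← mul_assoc]
      have := hN n hn
      gcongr
  have hstep : ∀ᶠ n in atTop, (partialProd q (n + 1) : ℝ) ^ s ≤ (partialProd q n : ℝ) ^ r := by
    have hε : 0 < r / s - 1 := sub_pos.2 ((one_lt_div hs).2 hsr)
    filter_upwards [hlog.eventually_lt_const hε, eventually_ge_atTop 1] with n hn hn1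
    have h2 : (1 : ℝ) < partialProd q n := by
      exact_mod_cast (Nat.one_lt_two_pow (by omega)).trans_le (two_pow_le_partialProd hq n)
    have hl := Real.log_pos h2
    rw [div_lt_iff₀ hl] at hn
    rw [← Real.log_le_log_iff (Real.rpow_pos_of_pos (hQpos _) s)
      (Real.rpow_pos_of_pos (hQpos n) r), Real.log_rpow (hQpos _), Real.log_rpow (hQpos n),
      partialProd_succ, Nat.cast_mul, Real.log_mul (hQpos n).ne' (hqpos n).ne']
    calc s * (Real.log (partialProd q n) + Real.log (q n))
        ≤ s * (Real.log (partialProd q n) + (r / s - 1) * Real.log (partialProd q n)) := by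
          gcongr
      _ = r * Real.log (partialProd q n) := by field_simp; ring
  have hO : (fun n => (partialProd q (n + 1) : ℝ) ^ s) =O[atTop]
      fun n => (partialProd M n : ℝ) := by
    refine Asymptotics.IsBigO.of_bound c ?_
    filter_upwards [hstep, eventually_ge_atTop N] with n h1 h2
    rw [Real.norm_of_nonneg (Real.rpow_nonneg (hQpos _).le _), Real.norm_of_nonneg (hPpos n).le]
    exact h1.trans (hQP n h2)
  obtain ⟨C, hC⟩ := (Asymptotics.isBigO_nat_atTop_iff
    fun n h => absurd h (hPpos n).ne').1 hO
  refine ⟨|C|, abs_nonneg C, fun n => ?_⟩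
  have := hC n
  rw [Real.norm_of_nonneg (Real.rpow_nonneg (hQpos _).le _), Real.norm_of_nonneg (hPpos n).le]
    at this
  exact this.trans (mul_le_mul_of_nonneg_right (le_abs_self C) (hPpos n).le)

/-! ### Accumulation sets -/

theorem accumulationSet_subset_of_tendsto_sub {u v : ℕ → ℝ}
    (h : Tendsto (fun n => v n - u n) atTop (𝓝 0)) : accumulationSet u ⊆ accumulationSet v := by
  intro y hy
  obtain ⟨U, hU, hy⟩ := mapClusterPt_iff_ultrafilter.1 (show MapClusterPt y atTop u from hy)
  refine mapClusterPt_iff_ultrafilter.2 ⟨U, hU, ?_⟩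
  simpa using hy.add (h.mono_left hU)

theorem accumulationSet_eq_of_tendsto_sub {u v : ℕ → ℝ}
    (h : Tendsto (fun n => u n - v n) atTop (𝓝 0)) : accumulationSet u = accumulationSet v := by
  refine (accumulationSet_subset_of_tendsto_sub ?_).antisymm
    (accumulationSet_subset_of_tendsto_sub h)
  simpa using h.neg

theorem exists_accumulationSet_eq {D : Set ℝ} (hD : IsClosed D) (hne : D.Nonempty) :
    ∃ d : ℕ → ℝ, (∀ n, d n ∈ D) ∧ accumulationSet d = D := by
  have : Nonempty D := hne.to_subtype
  -- The first unpaired coordinate takes each value infinitely often.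
  refine ⟨fun n => TopologicalSpace.denseSeq D n.unpair.1, fun n => Subtype.prop _,
    Set.Subset.antisymm (fun y hy => ?_) (fun y hy => ?_)⟩
  · exact hD.mem_of_mapClusterPt hy (Eventually.of_forall fun n => Subtype.prop _)
  · refine mapClusterPt_iff_frequently.2 fun V hV => ?_
    have hV' : ((↑) : D → ℝ) ⁻¹' V ∈ 𝓝 (⟨y, hy⟩ : D) := continuousAt_subtype_val hV
    obtain ⟨i, hi⟩ := (TopologicalSpace.denseRange_denseSeq D).mem_nhds hV'
    rw [frequently_atTop]
    intro n
    exact ⟨Nat.pair i n, Nat.right_le_pair i n, by simpa using hi⟩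

/-! ### Choice of the windows and the dimension -/

/-- Windows of about `q n ^ r` digits placed at `d n * q n`; finitely many of them have to be
replaced by the single digit `0` to respect the constraints at every position. -/
theorem exists_digit_windows {q t : ℕ → ℕ} (hq : IsBasicSequence q)
    (hq_inf : Tendsto q atTop atTop) (ht : Tendsto (fun n => (t n : ℝ) / (q n : ℝ)) atTop (𝓝 0))
    (hqt : ∀ n, t n + 3 ≤ q n) {r b : ℝ} (hr : r < 1) (hb : b < 1) {d : ℕ → ℝ}
    (hd0 : ∀ n, 0 ≤ d n) (hdb : ∀ n, d n ≤ b) :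
    ∃ a M : ℕ → ℕ, (∀ n, 1 ≤ M n) ∧ (∀ n, 2 * M n ≤ q n + 1) ∧
      (∀ n, a n + M n + t n < q n) ∧ (∀ᶠ n in atTop, (q n : ℝ) ^ r ≤ M n) ∧
      Tendsto (fun n => (M n : ℝ) / q n) atTop (𝓝 0) ∧
      Tendsto (fun n => (a n : ℝ) / q n - d n) atTop (𝓝 0) := by
  have hqpos : ∀ n, (0 : ℝ) < q n := fun n => by exact_mod_cast two_pos.trans_le (hq n)
  have hq_inf' : Tendsto (fun n => (q n : ℝ)) atTop atTop :=
    tendsto_natCast_atTop_atTop.comp hq_inf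
  have hinv : Tendsto (fun n => 1 / (q n : ℝ)) atTop (𝓝 0) := hq_inf'.const_div_atTop 1
  have hpow : Tendsto (fun n => ((q n : ℝ) ^ r + 1) / q n) atTop (𝓝 0) := by
    have h1 := (tendsto_rpow_neg_atTop (sub_pos.2 hr)).comp hq_inf'
    have h2 := h1.add hinv
    rw [add_zero] at h2
    refine h2.congr fun n => ?_
    simp only [Function.comp]
    rw [add_div, neg_sub, Real.rpow_sub_one (hqpos n).ne']
  set M' : ℕ → ℕ := fun n => ⌈(q n : ℝ) ^ r⌉₊
  set a' : ℕ → ℕ := fun n => ⌊d n * q n⌋₊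
  have hM'le : ∀ n, (M' n : ℝ) ≤ (q n : ℝ) ^ r + 1 := fun n =>
    (Nat.ceil_lt_add_one (Real.rpow_nonneg (hqpos n).le r)).le
  have ha'le : ∀ n, (a' n : ℝ) ≤ d n * q n := fun n =>
    Nat.floor_le (mul_nonneg (hd0 n) (hqpos n).le)
  have hM' : Tendsto (fun n => (M' n : ℝ) / q n) atTop (𝓝 0) :=
    squeeze_zero (fun n => by positivity)
      (fun n => div_le_div_of_nonneg_right (hM'le n) (hqpos n).le) hpow
  have ha' : Tendsto (fun n => (a' n : ℝ) / q n - d n) atTop (𝓝 0) := by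
    refine squeeze_zero_norm (fun n => ?_) hinv
    have h1 := ha'le n
    have h2 : d n * q n < a' n + 1 := Nat.lt_floor_add_one _
    have h3 : (a' n : ℝ) / q n - d n = (a' n - d n * q n) / q n := by
      have := (hqpos n).ne'
      field_simp
    rw [h3, norm_div, Real.norm_of_nonneg (hqpos n).le, Real.norm_eq_abs]
    have : |(a' n : ℝ) - d n * q n| ≤ 1 := by rw [abs_le]; constructor <;> linarith
    exact div_le_div_of_nonneg_right this (hqpos n).le
  have hgood : ∀ᶠ n in atTop, 2 * M' n ≤ q n + 1 ∧ a' n + M' n + t n < q n := by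
    have hsum := hM'.add ht
    rw [add_zero] at hsum
    filter_upwards [hM'.eventually_lt_const (half_pos one_pos),
      hsum.eventually_lt_const (sub_pos.2 hb)] with n h1 h2
    rw [div_lt_iff₀ (hqpos n)] at h1
    rw [← add_div, div_lt_iff₀ (hqpos n)] at h2
    have h3 : d n * q n ≤ b * q n := mul_le_mul_of_nonneg_right (hdb n) (hqpos n).le
    have h4 := ha'le n
    constructor
    · have : 2 * (M' n : ℝ) ≤ q n + 1 := by linarith
      exact_mod_cast this
    · have : (a' n : ℝ) + M' n + t n < q n := by linarith
      exact_mod_cast this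
  obtain ⟨N, hN⟩ := eventually_atTop.1 hgood
  have hge : ∀ᶠ n in atTop, ¬ n < N := (eventually_ge_atTop N).mono fun n h => h.not_gt
  refine ⟨fun n => if n < N then 0 else a' n, fun n => if n < N then 1 else M' n,
    fun n => ?_, fun n => ?_, fun n => ?_, ?_, ?_, ?_⟩
  · dsimp only
    split_ifs
    · exact le_rfl
    · exact Nat.ceil_pos.2 (Real.rpow_pos_of_pos (hqpos n) r)
  · dsimp only
    split_ifs with h
    · have := hq n
      omega
    · exact (hN n (not_lt.1 h)).1
  · dsimp only
    split_ifs with h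
    · have := hqt n
      omega
    · exact (hN n (not_lt.1 h)).2
  · filter_upwards [hge] with n hn
    rw [if_neg hn]
    exact Nat.le_ceil _
  · refine hM'.congr' ?_
    filter_upwards [hge] with n hn
    rw [if_neg hn]
  · refine ha'.congr' ?_
    filter_upwards [hge] with n hn
    rw [if_neg hn]

theorem mainTheorem5 (D : Set ℝ) (hD : D ⊆ Set.Ioo 0 1) (hDclosed : IsClosed D)
    (hDne : D.Nonempty) (q t : ℕ → ℕ) (hq : IsBasicSequence q)
    (hq_inf : Tendsto q atTop atTop)
    (hlog : ∀ j : ℕ, Tendsto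
      (fun n => Real.log (q (n + j) : ℝ) / Real.log (partialProd q n : ℝ)) atTop (𝓝 0))
    (hsum : Summable (fun n => (t n : ℝ) / (q n : ℝ)))
    (hqt : ∀ n, (3 : ℤ) ≤ (q n : ℤ) - (t n : ℤ)) :
    dimH (restrictedAccumulationSet D t q) = 1 := by
  refine le_antisymm ((dimH_mono (Set.subset_univ _)).trans Real.dimH_univ.le) ?_
  have hcompact : IsCompact D :=
    Metric.isCompact_of_isClosed_isBounded hDclosed ((Metric.isBounded_Ioo 0 1).subset hD)
  obtain ⟨b, hbD, hb⟩ := hcompact.exists_isGreatest hDne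
  obtain ⟨d, hdD, hd⟩ := exists_accumulationSet_eq hDclosed hDne
  refine ENNReal.le_of_forall_nnreal_lt fun s hs1 => ?_
  rcases eq_or_ne s 0 with rfl | hs0
  · simp
  have hs : 0 < s := pos_iff_ne_zero.2 hs0
  have hs1' : (s : ℝ) < 1 := by exact_mod_cast hs1
  obtain ⟨r, hsr, hr⟩ := exists_between hs1'
  obtain ⟨a, M, hM, hMq, haMt, hMr, hM0, ha0⟩ := exists_digit_windows hq hq_inf
    hsum.tendsto_atTop_zero (fun n => by have := hqt n; omega) hr (hD hbD).2
    (fun n => (hD (hdD n)).1.le) (fun n => hb (hdD n))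
  obtain ⟨C, hC, hprod⟩ := exists_partialProd_rpow_le hq (by simpa using hlog 0) hM
    (by exact_mod_cast hs) hsr hMr
  refine le_dimH_of_digit_windows (a := a) hq hM hMq (fun n => by have := haMt n; omega) hs hC
    hprod fun k hk => ⟨fun n => a n + k n, ?_, ?_, fun n => ?_⟩
  · refine isCantorExpansion_cantorValue hq fun n => ?_
    have := haMt n
    have := hk n
    omega
  · rw [← hd]
    refine accumulationSet_eq_of_tendsto_sub ?_
    have hk0 : Tendsto (fun n => (k n : ℝ) / q n) atTop (𝓝 0) := by
      refine squeeze_zero (fun n => by positivity) (fun n => ?_) hM0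
      have : (k n : ℝ) ≤ M n := by exact_mod_cast (hk n).le
      gcongr
    have := ha0.add hk0
    rw [add_zero] at this
    refine this.congr fun n => ?_
    push_cast
    ring
  · have := haMt n
    have := hk n
    push_cast
    omega
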